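/- Formulas are those of the infinitary logic $L_{\omega_1\omega}$ in the language of groups (identity, inverse, operation). $\Sigma_0=\Pi_0$ formulas are the finitary quantifier-free formulas; for $0<\alpha<\omega$, a $\Sigma_\alpha$ formula is a countable disjunction of formulas $\exists\bar u\,\psi_i(\bar x,\bar u)$ with each $\psi_i$ in $\Pi_{\beta}$ for some $\beta<\alpha$ (depending on $i$), and a $\Pi_\alpha$ formula is a countable conjunction of formulas $\forall\bar u\,\psi_i(\bar x,\bar u)$ with each $\psi_i$ in $\Sigma_{\beta}$ for some $\beta<\alpha$. A Scott sentence of a countable structure $\mathcal A$ is a sentence whose countable models are exactly the countable structures isomorphic to $\mathcal A$. Let $G$ be the subgroup of $(\mathbb{Q},+)$ generated by all $\frac1p$, $p$ prime. Then: 1. $G$ belongs to $\operatorname{TFAb}_1$, the class of torsion-free abelian groups of rank $1$. 2. $G$ has no $\Pi_3$ Scott sentence. Moreover, no $\Pi_3$ sentence has the property that its models with universe $\omega$ are exactly the structures with universe $\omega$ isomorphic to $G$. 3. The orbit of $1$ under the automorphism group of $G$ is not defined in $G$ by any (parameter-free) $\Sigma_2$ formula $\varphi(x)$. In particular, there exists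 a group in $\operatorname{TFAb}_1$ with no $\Pi_3$ Scott sentence. -/

import Mathlib

open scoped FirstOrder

universe u v w

/-- Formulas of the infinitary logic `L_{ω₁ω}` over the language `L`, with free variables among
`x₀, …, x_{n-1}`: built from finitary quantifier-free formulas by negation, countable disjunctions
and conjunctions, and quantification of one variable (the last one). -/
inductive InfFormula (L : FirstOrder.Language.{u, v}) : ℕ → Type (max u v)
  | qf {n : ℕ} (φ : L.Formula (Fin n)) (h : φ.IsQF) : InfFormula L n
  | not {n : ℕ} (φ : InfFormula L n) : InfFormula L n
  | iSup {n : ℕ} (φ : ℕ → InfFormula L n) : InfFormula L n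
  | iInf {n : ℕ} (φ : ℕ → InfFormula L n) : InfFormula L n
  | ex {n : ℕ} (φ : InfFormula L (n + 1)) : InfFormula L n
  | all {n : ℕ} (φ : InfFormula L (n + 1)) : InfFormula L n

/-- Sentences of `L_{ω₁ω}`. -/
abbrev InfSentence (L : FirstOrder.Language.{u, v}) : Type (max u v) := InfFormula L 0

namespace InfFormula

/-- Satisfaction of a formula in an `L`-structure by a tuple. -/
def Realize {L : FirstOrder.Language.{u, v}} {M : Type w} [L.Structure M] :
    {n : ℕ} → InfFormula L n → (Fin n → M) → Prop
  | _, qf φ _, x => φ.Realize x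
  | _, not φ, x => ¬ Realize φ x
  | _, iSup φ, x => ∃ i, Realize (φ i) x
  | _, iInf φ, x => ∀ i, Realize (φ i) x
  | n, ex φ, x => ∃ y : M, Realize φ (Fin.snoc (α := fun _ : Fin (n + 1) => M) x y)
  | n, all φ, x => ∀ y : M, Realize φ (Fin.snoc (α := fun _ : Fin (n + 1) => M) x y)

/-- Existential quantification of the last `k` variables. -/
def exs {L : FirstOrder.Language.{u, v}} {n : ℕ} : (k : ℕ) → InfFormula L (n + k) → InfFormula L n
  | 0, φ => φ
  | k + 1, φ => exs k (ex φ)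

/-- Universal quantification of the last `k` variables. -/
def alls {L : FirstOrder.Language.{u, v}} {n : ℕ} : (k : ℕ) → InfFormula L (n + k) → InfFormula L n
  | 0, φ => φ
  | k + 1, φ => alls k (all φ)

/-- The two sides of the hierarchy of infinitary formulas. -/
inductive Side
  | sigma
  | pi

/-- The (finite levels of the) hierarchy of infinitary formulas:
* `Σ₀ = Π₀` consists of the finitary quantifier-free formulas;
* for `α > 0`, a `Σ_α` formula is a countable disjunction of formulas `∃ ū, ψᵢ(x̄, ū)`, where
  each `ψᵢ` is `Π_β` for some `β < α`;
* for `α > 0`, a `Π_α` formula is a countable conjunction of formulas `∀ ū, ψᵢ(x̄, ū)`, where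
  each `ψᵢ` is `Σ_β` for some `β < α`. -/
inductive Classified {L : FirstOrder.Language.{u, v}} : Side → ℕ → {n : ℕ} → InfFormula L n → Prop
  | qf (s : Side) {n : ℕ} (φ : L.Formula (Fin n)) (h : φ.IsQF) : Classified s 0 (qf φ h)
  | sigma {α n : ℕ} (k β : ℕ → ℕ) (ψ : (i : ℕ) → InfFormula L (n + k i))
      (hβ : ∀ i, β i < α) (hψ : ∀ i, Classified Side.pi (β i) (ψ i)) :
      Classified Side.sigma α (iSup fun i => exs (k i) (ψ i))
  | pi {α n : ℕ} (k β : ℕ → ℕ) (ψ : (i : ℕ) → InfFormula L (n + k i))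
      (hβ : ∀ i, β i < α) (hψ : ∀ i, Classified Side.sigma (β i) (ψ i)) :
      Classified Side.pi α (iInf fun i => alls (k i) (ψ i))

/-- `φ` is a `Σ_α` formula. -/
def IsSigma {L : FirstOrder.Language.{u, v}} {n : ℕ} (α : ℕ) (φ : InfFormula L n) : Prop :=
  Classified Side.sigma α φ

/-- `φ` is a `Π_α` formula. -/
def IsPi {L : FirstOrder.Language.{u, v}} {n : ℕ} (α : ℕ) (φ : InfFormula L n) : Prop :=
  Classified Side.pi α φ

end InfFormula

/-- Truth of an infinitary sentence in an `L`-structure. -/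
def InfSentence.Holds {L : FirstOrder.Language.{u, v}} (φ : InfSentence L) (M : Type w) [L.Structure M] :
    Prop :=
  InfFormula.Realize φ (Fin.elim0 : Fin 0 → M)

/-- `φ` is a Scott sentence of `M`: its countable models are exactly the countable structures
isomorphic to `M`. -/
def IsScottSentence {L : FirstOrder.Language.{u, v}} (φ : InfSentence L) (M : Type w) [L.Structure M] :
    Prop :=
  ∀ (N : Type) [L.Structure N] [Countable N], φ.Holds N ↔ Nonempty (N ≃[L] M)

/-- The version of `IsScottSentence` in which only structures with universe `ω` are considered:
among these, the models of `φ` are exactly the isomorphic copies of `M`. -/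
def IsScottSentenceOnOmega {L : FirstOrder.Language.{u, v}} (φ : InfSentence L) (M : Type w)
    [L.Structure M] : Prop :=
  ∀ (_ : L.Structure ℕ), φ.Holds ℕ ↔ Nonempty (ℕ ≃[L] M)

/-- The orbit of an element under the automorphism group of an `L`-structure. -/
def autOrbit (L : FirstOrder.Language.{u, v}) {M : Type w} [L.Structure M] (a : M) : Set M :=
  {b | ∃ σ : M ≃[L] M, σ a = b}

/-- The formula `φ(x)` defines (without parameters) the set `S`. -/
def InfFormula.Defines {L : FirstOrder.Language.{u, v}} {M : Type w} [L.Structure M] (φ : InfFormula L 1)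
    (S : Set M) : Prop :=
  ∀ a : M, φ.Realize ![a] ↔ a ∈ S

/-- The function symbols of the language of groups: identity, inverse and the operation. -/
inductive GroupFunc : ℕ → Type
  | zero : GroupFunc 0
  | neg : GroupFunc 1
  | add : GroupFunc 2

/-- The language of groups, written additively. -/
def groupLang : FirstOrder.Language.{0, 0} where
  Functions := GroupFunc
  Relations := fun _ => Empty

/-- Every additive group is a structure for the language of groups. -/
instance groupStructure (A : Type w) [AddGroup A] : groupLang.Structure A where
  funMap := fun {_} f =>
    match f with
    | GroupFunc.zero => fun _ => 0
    | GroupFunc.neg => fun x => -x 0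
    | GroupFunc.add => fun x => x 0 + x 1
  RelMap := fun {_} r => nomatch r

/-- `A` belongs to the class `TFAb_r` of torsion-free abelian groups of rank `r`. -/
def IsTFAb (r : ℕ) (A : Type w) [AddCommGroup A] : Prop :=
  IsAddTorsionFree A ∧ Module.rank ℤ A = r

/-- The subgroup of `ℚ` generated by the numbers `1/p`, for `p` prime. -/
def primeRecipGroup : AddSubgroup ℚ :=
  AddSubgroup.closure {x | ∃ p : ℕ, p.Prime ∧ x = 1 / (p : ℚ)}

theorem one_mem_primeRecipGroup : (1 : ℚ) ∈ primeRecipGroup := by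
  have h : (1 / ((2 : ℕ) : ℚ)) ∈ primeRecipGroup :=
    AddSubgroup.subset_closure ⟨2, Nat.prime_two, rfl⟩
  have h2 := add_mem h h
  norm_num at h2
  exact h2

/-! `primeRecipGroup` is the group G of rationals with squarefree denominator. For a set Q of
primes, let G_Q = `avoidingGroup Q` be the part of G integral at every prime of Q. Multiplication by
∏F shows G ≅ G_F for finite F (`nonempty_equiv_avoidingGroup`), whereas for infinite Q an
isomorphism would send 1 to an element divisible by every prime of Q, hence to 0
(`isEmpty_equiv_avoidingGroup`).

A true Σ₂ formula passes to every substructure containing finitely many witnesses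
(`IsSigma.exists_finset_realize`), and removing only primes larger than their denominators keeps
those witnesses. If a Π₃ sentence holds in G, it holds in each G_F. Adding ever larger primes to F,
and preserving one Σ₂ instance at each stage, produces an infinite Q with the sentence true in G_Q
(`exists_avoidingGroup_holds`). So it is no Scott sentence.

The same persistence, applied to multiplication by a large prime q, carries a Σ₂ property of 1 to
1/q, which lies outside the orbit of 1. -/

namespace InfFormula

/-! ### Persistence of formulas along embeddings. -/

section Logic

variable {L : FirstOrder.Language.{u, v}}

theorem realize_exs {M : Type*} [L.Structure M] {n : ℕ} (k : ℕ) (φ : InfFormula L (n + k))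
    (x : Fin n → M) :
    (exs k φ).Realize x ↔ ∃ z : Fin (n + k) → M, z ∘ Fin.castAdd k = x ∧ φ.Realize z := by
  induction k with
  | zero => exact ⟨fun h => ⟨x, rfl, h⟩, fun ⟨z, hz, h⟩ => hz ▸ h⟩
  | succ k ih =>
    refine (ih (ex φ)).trans ⟨?_, ?_⟩
    · rintro ⟨z, rfl, y, hy⟩
      refine ⟨Fin.snoc (α := fun _ => M) z y, ?_, hy⟩
      funext i
      exact Fin.snoc_castSucc (α := fun _ : Fin (n + k + 1) => M) y z (Fin.castAdd k i)
    · rintro ⟨z, rfl, hz⟩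
      refine ⟨fun i => z i.castSucc, rfl, z (Fin.last _), ?_⟩
      exact (iff_of_eq (congrArg (Realize (n := n + k + 1) φ)
        (Fin.snoc_init_self (α := fun _ : Fin (n + k + 1) => M) z))).2 hz

theorem realize_alls {M : Type*} [L.Structure M] {n : ℕ} (k : ℕ) (φ : InfFormula L (n + k))
    (x : Fin n → M) :
    (alls k φ).Realize x ↔ ∀ z : Fin (n + k) → M, z ∘ Fin.castAdd k = x → φ.Realize z := by
  induction k with
  | zero => exact ⟨fun h z hz => (show z = x from hz) ▸ h, fun h => h x rfl⟩
  | succ k ih =>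
    refine (ih (all φ)).trans ⟨?_, ?_⟩
    · rintro h z rfl
      exact (iff_of_eq (congrArg (Realize (n := n + k + 1) φ)
        (Fin.snoc_init_self (α := fun _ : Fin (n + k + 1) => M) z))).1
        (h (fun i => z i.castSucc) rfl (z (Fin.last _)))
    · rintro h z rfl y
      refine h (Fin.snoc (α := fun _ => M) z y) ?_
      funext i
      exact Fin.snoc_castSucc (α := fun _ : Fin (n + k + 1) => M) y z (Fin.castAdd k i)

/-- Quantifier-free formulas are preserved and reflected by embeddings. -/
theorem realize_qf_embedding {M N : Type*} [L.Structure M] [L.Structure N] (f : M ↪[L] N) {n : ℕ}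
    {φ : L.Formula (Fin n)} (h : φ.IsQF) (x : Fin n → M) :
    φ.Realize (f ∘ x) ↔ φ.Realize x := by
  have := h.realize_embedding f (v := x) (xs := default)
  rw [Subsingleton.elim (f ∘ default) default] at this
  exact this

/-- Satisfaction is invariant under isomorphism. -/
theorem realize_equiv {M N : Type*} [L.Structure M] [L.Structure N] (e : M ≃[L] N) {n : ℕ}
    (φ : InfFormula L n) (x : Fin n → M) : φ.Realize (e ∘ x) ↔ φ.Realize x := by
  have snoc {n : ℕ} (x : Fin n → M) (y : M) :
      Fin.snoc (α := fun _ : Fin (n + 1) => N) (e ∘ x) (e y) =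
        e ∘ Fin.snoc (α := fun _ : Fin (n + 1) => M) x y :=
    (Fin.comp_snoc e x y).symm
  induction φ with
  | qf φ h => exact realize_qf_embedding e.toEmbedding h x
  | not φ ih => exact not_congr (ih x)
  | iSup φ ih => exact exists_congr fun i => ih i x
  | iInf φ ih => exact forall_congr' fun i => ih i x
  | ex φ ih =>
    refine (e.toEquiv.surjective.exists).trans (exists_congr fun y => ?_)
    exact (iff_of_eq (congrArg φ.Realize (snoc x y))).trans (ih _)
  | all φ ih =>
    refine (e.toEquiv.surjective.forall).trans (forall_congr' fun y => ?_)
    exact (iff_of_eq (congrArg φ.Realize (snoc x y))).trans (ih _)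

theorem realize_of_isSigma_zero {M N : Type*} [L.Structure M] [L.Structure N] (f : M ↪[L] N)
    {n : ℕ} {φ : InfFormula L n} (hφ : φ.IsSigma 0) (x : Fin n → M) :
    φ.Realize (f ∘ x) ↔ φ.Realize x := by
  cases hφ with
  | qf _ φ h => exact realize_qf_embedding f h x
  | sigma k β ψ hβ hψ => exact absurd (hβ 0) (Nat.not_lt_zero _)

/-- `Π₁` formulas are reflected by embeddings. -/
theorem IsPi.realize_of_embedding {M N : Type*} [L.Structure M] [L.Structure N] (f : M ↪[L] N)
    {α n : ℕ} (hα : α ≤ 1) {φ : InfFormula L n} (hφ : φ.IsPi α) {x : Fin n → M}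
    (h : φ.Realize (f ∘ x)) : φ.Realize x := by
  cases hφ with
  | qf _ φ hq => exact (realize_qf_embedding f hq x).1 h
  | pi k β ψ hβ hψ =>
    intro i
    rw [realize_alls]
    rintro z rfl
    have hi : IsSigma 0 (ψ i) := by
      have := hψ i
      rwa [show β i = 0 by have := hβ i; omega] at this
    exact (realize_of_isSigma_zero f hi z).1 ((realize_alls _ _ _).1 (h i) (f ∘ z) rfl)

/-- A true `Σ₂` formula remains true in every substructure containing a certain finite set. -/
theorem IsSigma.exists_finset_realize {M : Type*} [L.Structure M] {α n : ℕ} (hα : α ≤ 2)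
    {φ : InfFormula L n} (hφ : φ.IsSigma α) {x : Fin n → M} (h : φ.Realize x) :
    ∃ S : Finset M, ∀ (N : Type w) [L.Structure N] (f : N ↪[L] M) (y : Fin n → N),
      f ∘ y = x → (S : Set M) ⊆ Set.range f → φ.Realize y := by
  classical
  cases hφ with
  | qf _ φ hq =>
    refine ⟨∅, fun N _ f y hy _ => ?_⟩
    subst hy
    exact (realize_qf_embedding f hq y).1 h
  | sigma k β ψ hβ hψ =>
    obtain ⟨i, hi⟩ := h
    obtain ⟨z, rfl, hz⟩ := (realize_exs _ _ _).1 hi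
    -- The finite set consists of `x` and the existential witnesses; the remaining matrix is at most
    -- Π₁, so it passes down.
    refine ⟨Finset.univ.image z, fun N _ f y hy hS => ⟨i, (realize_exs _ _ _).2 ?_⟩⟩
    have hr (j) : ∃ t, f t = z j := hS (by simp)
    choose t ht using hr
    obtain rfl : f ∘ t = z := funext ht
    refine ⟨t, funext fun j => f.injective (congrFun hy j).symm, ?_⟩
    exact IsPi.realize_of_embedding f (by have := hβ i; omega) (hψ i) hz

end Logic

end InfFormula

/-! ### Isomorphisms of structures and of groups. -/

theorem InfSentence.holds_congr {L : FirstOrder.Language.{u, v}} {M N : Type*} [L.Structure M]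
    [L.Structure N] (e : M ≃[L] N) (φ : InfSentence L) : φ.Holds M ↔ φ.Holds N := by
  rw [InfSentence.Holds, InfSentence.Holds, ← InfFormula.realize_equiv e φ,
    Subsingleton.elim (e ∘ Fin.elim0) Fin.elim0]

/-- An injective homomorphism of additive groups is an embedding of structures. -/
def AddMonoidHom.toGroupLangEmbedding {A B : Type*} [AddGroup A] [AddGroup B] (f : A →+ B)
    (hf : Function.Injective f) : A ↪[groupLang] B where
  toFun := f
  inj' := hf
  map_fun' := fun {_} g x => by
    cases g with
    | zero => exact map_zero f
    | neg => exact map_neg f _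
    | add => exact map_add f _ _
  map_rel' := fun {_} r => nomatch r

/-- An isomorphism of additive groups is an isomorphism of structures. -/
def AddEquiv.toGroupLangEquiv {A B : Type*} [AddGroup A] [AddGroup B] (e : A ≃+ B) :
    A ≃[groupLang] B where
  toEquiv := e.toEquiv
  map_fun' := fun {_} g x => by
    cases g with
    | zero => exact map_zero e
    | neg => exact map_neg e _
    | add => exact map_add e _ _
  map_rel' := fun {_} r => nomatch r

theorem groupLangEquiv_map_add {A B : Type*} [AddGroup A] [AddGroup B] (e : A ≃[groupLang] B)
    (a b : A) : e (a + b) = e a + e b :=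
  e.map_fun GroupFunc.add ![a, b]

theorem groupLangEquiv_map_nsmul {A B : Type*} [AddGroup A] [AddGroup B] (e : A ≃[groupLang] B)
    (n : ℕ) (a : A) : e (n • a) = n • e a :=
  map_nsmul (AddEquiv.mk' e.toEquiv (groupLangEquiv_map_add e)) n a

/-! ### The groups G_Q and their p-adic description. -/

/-- The rational numbers `x` whose denominator is square-free and prime to all primes in `Q`,
described by `|x|_p ≤ p` for all `p` and `|x|_p ≤ 1` for `p ∈ Q`. -/
def avoidingGroup (Q : Set ℕ) : AddSubgroup ℚ where
  carrier := {x | ∀ p : ℕ, p.Prime → padicNorm p x ≤ p ∧ (p ∈ Q → padicNorm p x ≤ 1)}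
  zero_mem' := fun p _ => by simp
  add_mem' := fun {x y} hx hy p hp => by
    have : Fact p.Prime := ⟨hp⟩
    exact ⟨padicNorm.nonarchimedean.trans (max_le (hx p hp).1 (hy p hp).1),
      fun hQ => padicNorm.nonarchimedean.trans (max_le ((hx p hp).2 hQ) ((hy p hp).2 hQ))⟩
  neg_mem' := fun {x} hx p hp => by simpa using hx p hp

theorem avoidingGroup_anti {P Q : Set ℕ} (h : P ⊆ Q) : avoidingGroup Q ≤ avoidingGroup P :=
  fun _ hx p hp => ⟨(hx p hp).1, fun hP => (hx p hp).2 (h hP)⟩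

theorem padicNorm_le_one_of_den_lt {p : ℕ} (hp : p.Prime) {x : ℚ} (h : x.den < p) :
    padicNorm p x ≤ 1 := by
  have : Fact p.Prime := ⟨hp⟩
  have hd : padicNorm p (x.den : ℚ) = 1 :=
    (padicNorm.nat_eq_one_iff _).2 fun hdvd => absurd (Nat.le_of_dvd x.pos hdvd) (by omega)
  rw [← Rat.num_div_den x, padicNorm.div, hd, div_one]
  exact padicNorm.of_int _

theorem one_div_mem_primeRecipGroup {p : ℕ} (hp : p.Prime) : 1 / (p : ℚ) ∈ primeRecipGroup :=
  AddSubgroup.subset_closure ⟨p, hp, rfl⟩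

/-- Partial fractions: if up + va = 1, then 1/(pa) = u/a + v/p. -/
theorem one_div_mem_primeRecipGroup_of_squarefree {d : ℕ} (hd : Squarefree d) :
    1 / (d : ℚ) ∈ primeRecipGroup := by
  induction d using induction_on_primes with
  | zero => simp
  | one => simpa using one_mem_primeRecipGroup
  | prime_mul p a hp ih =>
    have ha := ih (hd.of_mul_right)
    have hco : IsCoprime (p : ℤ) a := Nat.isCoprime_iff_coprime.2 (Nat.coprime_of_squarefree_mul hd)
    obtain ⟨u, v, huv⟩ := hco
    have hp0 : (p : ℚ) ≠ 0 := by exact_mod_cast hp.ne_zero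
    have ha0 : (a : ℚ) ≠ 0 := by
      rintro h
      rw [Nat.cast_eq_zero] at h
      simp [h] at hd
    have huv' : (u : ℚ) * p + v * a = 1 := by exact_mod_cast huv
    have := add_mem (primeRecipGroup.zsmul_mem ha u)
      (primeRecipGroup.zsmul_mem (one_div_mem_primeRecipGroup hp) v)
    convert this using 1
    push_cast
    simp only [zsmul_eq_mul]
    field_simp
    linarith

theorem padicNorm_one_div {p q : ℕ} (hp : p.Prime) (hq : q.Prime) :
    padicNorm p (1 / (q : ℚ)) = if p = q then (p : ℚ) else 1 := by
  have : Fact p.Prime := ⟨hp⟩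
  have : Fact q.Prime := ⟨hq⟩
  rw [padicNorm.div, padicNorm.one]
  split_ifs with h
  · subst h
    rw [padicNorm.padicNorm_p_of_prime, one_div, inv_inv]
  · rw [padicNorm.padicNorm_of_prime_of_ne h, div_one]

theorem primeRecipGroup_eq : primeRecipGroup = avoidingGroup ∅ := by
  apply le_antisymm
  · refine (AddSubgroup.closure_le _).2 ?_
    rintro _ ⟨q, hq, rfl⟩ p hp
    refine ⟨?_, fun h => h.elim⟩
    rw [padicNorm_one_div hp hq]
    split_ifs
    · exact le_rfl
    · exact_mod_cast hp.one_lt.le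
  · intro x hx
    -- If p² divided the denominator, the bound |x|_p ≤ p would make p divide the numerator as well.
    have hsq : Squarefree x.den := by
      rw [Nat.squarefree_iff_prime_squarefree]
      rintro p hp ⟨c, hc⟩
      have : Fact p.Prime := ⟨hp⟩
      have hp0 : (0 : ℚ) < p := by exact_mod_cast hp.pos
      have hnum : padicNorm p (x.num : ℚ) = 1 := by
        refine (padicNorm.int_eq_one_iff _).2 fun h => ?_
        have h1 := Int.natCast_dvd.1 h
        have h2 : p ∣ x.den := ⟨p * c, by rw [hc, mul_assoc]⟩
        exact hp.one_lt.ne' (Nat.dvd_one.1 (x.reduced ▸ Nat.dvd_gcd h1 h2))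
      have hx' : (x.num : ℚ) = x * p * (p * c) := by
        have := Rat.mul_den_eq_num x
        rw [← this, hc]
        push_cast
        ring
      rw [hx', padicNorm.mul, padicNorm.mul, padicNorm.mul, padicNorm.padicNorm_p_of_prime] at hnum
      have h1 : padicNorm p x * (p : ℚ)⁻¹ ≤ 1 := by
        rw [← div_eq_mul_inv, div_le_one hp0]
        exact (hx p hp).1
      have h2 : (p : ℚ)⁻¹ * padicNorm p (c : ℚ) < 1 :=
        mul_lt_one_of_nonneg_of_lt_one_left (inv_nonneg.2 hp0.le)
          (inv_lt_one_of_one_lt₀ (by exact_mod_cast hp.one_lt)) (padicNorm.of_nat c)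
      have h3 := mul_lt_one_of_nonneg_of_lt_one_right h1
        (mul_nonneg (inv_nonneg.2 hp0.le) (padicNorm.nonneg _)) h2
      exact h3.ne hnum
    have := primeRecipGroup.zsmul_mem (one_div_mem_primeRecipGroup_of_squarefree hsq) x.num
    convert this using 1
    rw [zsmul_eq_mul, mul_one_div, Rat.num_div_den]

theorem mem_primeRecipGroup {x : ℚ} :
    x ∈ primeRecipGroup ↔ ∀ p : ℕ, p.Prime → padicNorm p x ≤ p := by
  rw [primeRecipGroup_eq]
  exact forall₂_congr fun p _ => by simp

theorem padicNorm_prod_primes {F : Finset ℕ} (hF : ∀ p ∈ F, p.Prime) {p : ℕ} (hp : p.Prime) :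
    padicNorm p ((∏ q ∈ F, q : ℕ) : ℚ) = if p ∈ F then (p : ℚ)⁻¹ else 1 := by
  have : Fact p.Prime := ⟨hp⟩
  induction F using Finset.induction_on with
  | empty => simp
  | insert q F hq ih =>
    have : Fact q.Prime := ⟨hF q (Finset.mem_insert_self q F)⟩
    rw [Finset.prod_insert hq, Nat.cast_mul, padicNorm.mul,
      ih fun r hr => hF r (Finset.mem_insert_of_mem hr)]
    by_cases h : p = q
    · subst h
      simp [hq]
    · simp [h, padicNorm.padicNorm_of_prime_of_ne h]

/-- Multiplication by a product of distinct primes removes them from the denominators. -/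
theorem map_mulLeft_primeRecipGroup {F : Finset ℕ} (hF : ∀ p ∈ F, p.Prime) :
    primeRecipGroup.map (AddMonoidHom.mulLeft ((∏ q ∈ F, q : ℕ) : ℚ)) = avoidingGroup F := by
  have hm : ((∏ q ∈ F, q : ℕ) : ℚ) ≠ 0 := by
    exact_mod_cast Finset.prod_ne_zero_iff.2 fun p hp => (hF p hp).ne_zero
  rw [primeRecipGroup_eq]
  ext x
  constructor
  · rintro ⟨y, hy, rfl⟩ p hp
    have : Fact p.Prime := ⟨hp⟩
    have hp0 : (0 : ℚ) < p := by exact_mod_cast hp.pos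
    have hp1 : (1 : ℚ) ≤ p := by exact_mod_cast hp.one_lt.le
    rw [AddMonoidHom.coe_mulLeft, padicNorm.mul, padicNorm_prod_primes hF hp]
    have := (hy p hp).1
    split_ifs with h
    · have h1 : (p : ℚ)⁻¹ * padicNorm p y ≤ 1 := by
        rwa [← div_eq_inv_mul, div_le_one hp0]
      exact ⟨h1.trans hp1, fun _ => h1⟩
    · exact ⟨by rwa [one_mul], fun h' => absurd h' h⟩
  · intro hx
    refine ⟨((∏ q ∈ F, q : ℕ) : ℚ)⁻¹ * x, fun p hp => ⟨?_, fun h => h.elim⟩, ?_⟩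
    · have : Fact p.Prime := ⟨hp⟩
      have hp0 : (0 : ℚ) < p := by exact_mod_cast hp.pos
      rw [← div_eq_inv_mul, padicNorm.div, padicNorm_prod_primes hF hp]
      split_ifs with h
      · rw [div_inv_eq_mul]
        exact mul_le_of_le_one_left hp0.le ((hx p hp).2 h)
      · rw [div_one]
        exact (hx p hp).1
    · exact mul_inv_cancel_left₀ hm x

/-! ### Isomorphism types of the groups G_Q. -/

/-- Removing finitely many primes from the denominators does not change the isomorphism type. -/
theorem nonempty_equiv_avoidingGroup {F : Finset ℕ} (hF : ∀ p ∈ F, p.Prime) :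
    Nonempty (primeRecipGroup ≃+ avoidingGroup F) := by
  have hm : ((∏ q ∈ F, q : ℕ) : ℚ) ≠ 0 := by
    exact_mod_cast Finset.prod_ne_zero_iff.2 fun p hp => (hF p hp).ne_zero
  rw [← map_mulLeft_primeRecipGroup hF]
  exact ⟨primeRecipGroup.equivMapOfInjective _ (mul_right_injective₀ hm)⟩

/-- Removing infinitely many primes from the denominators changes the isomorphism type. -/
theorem isEmpty_equiv_avoidingGroup {Q : Set ℕ} (hQ : ∀ p ∈ Q, p.Prime) (hinf : Q.Infinite) :
    IsEmpty (primeRecipGroup ≃[groupLang] avoidingGroup Q) := by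
  refine ⟨fun e => ?_⟩
  set one : primeRecipGroup := ⟨1, one_mem_primeRecipGroup⟩ with hone
  set y := e one with hy
  -- Since 1 = q · (1/q) in G, its image is q times an element integral at q.
  have hdvd (q : ℕ) (hq : q ∈ Q) : q ∣ (y : ℚ).num.natAbs := by
    have hqp := hQ q hq
    have : Fact q.Prime := ⟨hqp⟩
    have hq0 : (q : ℚ) ≠ 0 := by exact_mod_cast hqp.ne_zero
    have h1 : q • (⟨1 / q, one_div_mem_primeRecipGroup hqp⟩ : primeRecipGroup) = one :=
      Subtype.ext (by simp [hone, hq0])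
    set z := e ⟨1 / q, one_div_mem_primeRecipGroup hqp⟩
    have h2 : (y : ℚ) = q * z := by
      rw [hy, ← h1, groupLangEquiv_map_nsmul, AddSubgroup.coe_nsmul, nsmul_eq_mul]
    have h3 : padicNorm q (y : ℚ) < 1 := by
      rw [h2, padicNorm.mul]
      exact mul_lt_one_of_nonneg_of_lt_one_left (padicNorm.nonneg _)
        padicNorm.padicNorm_p_lt_one_of_prime ((z.2 q hqp).2 hq)
    rw [← Int.natCast_dvd, ← padicNorm.int_lt_one_iff, ← Rat.mul_den_eq_num, padicNorm.mul]
    exact mul_lt_one_of_nonneg_of_lt_one_left (padicNorm.nonneg _) h3 (padicNorm.of_nat _)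
  obtain ⟨q, hq, hlt⟩ := hinf.exists_gt (y : ℚ).num.natAbs
  have hy0 : y = 0 := by
    have h0 := Nat.eq_zero_of_dvd_of_lt (hdvd q hq) hlt
    exact Subtype.ext (Rat.num_eq_zero.1 (Int.natAbs_eq_zero.1 h0))
  have h2 : e (one + one) = e one := by rw [groupLangEquiv_map_add, ← hy, hy0, add_zero]
  have h3 := congrArg Subtype.val (e.injective h2)
  norm_num [hone] at h3

/-! ### The rank of G and the orbit of 1. -/

theorem isTFAb_primeRecipGroup : IsTFAb 1 primeRecipGroup := by
  refine ⟨inferInstance, le_antisymm ?_ ?_⟩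
  · refine (LinearMap.rank_le_of_injective primeRecipGroup.subtype.toIntLinearMap
      Subtype.val_injective).trans ?_
    rw [← IsFractionRing.rank_right_eq ℤ ℚ ℚ, Module.rank_self, Nat.cast_one]
  · have : Nontrivial primeRecipGroup :=
      ⟨0, ⟨1, one_mem_primeRecipGroup⟩, fun h => zero_ne_one (congrArg Subtype.val h)⟩
    rw [Nat.cast_one, Cardinal.one_le_iff_pos, rank_pos_iff_nontrivial]
    exact this

/-- Multiplication by q embeds G in itself, sends 1/q to 1, and has as image the elements integral
at q. For large q the image contains the witnesses for 1, so the formula also holds at 1/q. -/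
theorem not_defines_autOrbit_one (φ : InfFormula groupLang 1) (hφ : φ.IsSigma 2) :
    ¬ φ.Defines (autOrbit groupLang (⟨1, one_mem_primeRecipGroup⟩ : primeRecipGroup)) := by
  intro hdef
  have hone := (hdef ⟨1, one_mem_primeRecipGroup⟩).2
    ⟨FirstOrder.Language.Equiv.refl groupLang primeRecipGroup, rfl⟩
  obtain ⟨S, hS⟩ := hφ.exists_finset_realize le_rfl hone
  obtain ⟨q, hqS, hq⟩ := Nat.exists_infinite_primes (S.sup (fun x => (x : ℚ).den) + 1)
  have : Fact q.Prime := ⟨hq⟩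
  have hq0 : (q : ℚ) ≠ 0 := by exact_mod_cast hq.ne_zero
  have hq1 : (1 : ℚ) < q := by exact_mod_cast hq.one_lt
  set a : primeRecipGroup := ⟨1 / q, one_div_mem_primeRecipGroup hq⟩ with ha
  have hqa : q • a = ⟨1, one_mem_primeRecipGroup⟩ := Subtype.ext (by simp [ha, hq0])
  let f : primeRecipGroup ↪[groupLang] primeRecipGroup :=
    (nsmulAddMonoidHom q).toGroupLangEmbedding fun x y h => nsmul_right_injective hq.ne_zero h
  have hreal : φ.Realize ![a] := by
    refine hS primeRecipGroup f ![a] ?_ ?_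
    · funext i
      rw [Subsingleton.elim i 0]
      exact hqa
    · intro x hx
      have hden : padicNorm q (x : ℚ) ≤ 1 := by
        refine padicNorm_le_one_of_den_lt hq (lt_of_le_of_lt ?_ hqS)
        exact Finset.le_sup (f := fun x : primeRecipGroup => (x : ℚ).den) hx
      refine ⟨⟨x / q, ?_⟩, Subtype.ext ?_⟩
      · refine mem_primeRecipGroup.2 fun p hp => ?_
        have : Fact p.Prime := ⟨hp⟩
        rw [div_eq_mul_one_div, padicNorm.mul, padicNorm_one_div hp hq]
        split_ifs with h
        · subst h
          exact mul_le_of_le_one_left (by positivity) hden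
        · rw [mul_one]
          exact mem_primeRecipGroup.1 x.2 p hp
      · change q • ((x : ℚ) / q) = x
        rw [nsmul_eq_mul, mul_div_cancel₀ _ hq0]
  obtain ⟨σ, hσ⟩ := (hdef a).1 hreal
  rw [← hqa, groupLangEquiv_map_nsmul] at hσ
  -- An automorphism sending 1 to 1/q would send 1/q to 1/q², which is not in G.
  have h1 : (q : ℚ) * σ a = 1 / q := by
    simpa [ha] using congrArg Subtype.val hσ
  have h2 : padicNorm q (σ a : ℚ) ≤ q := mem_primeRecipGroup.1 (σ a).2 q hq
  have h3 := congrArg (padicNorm q) h1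
  rw [padicNorm.mul, padicNorm_one_div hq hq, if_pos rfl, padicNorm.padicNorm_p_of_prime] at h3
  have h4 : (q : ℚ)⁻¹ * padicNorm q (σ a : ℚ) ≤ 1 := by
    rw [← div_eq_inv_mul]
    exact (div_le_one (by positivity)).2 h2
  linarith

/-! ### Transfer of Π₃ sentences from G to some G_Q with Q infinite. -/

/-- The bound is the largest denominator of a witness: deleting larger primes leaves every witness
in the group. -/
theorem exists_bound_realize {F : Set ℕ} {α n : ℕ} (hα : α ≤ 2) {φ : InfFormula groupLang n}
    (hφ : φ.IsSigma α) {x : Fin n → avoidingGroup F} (h : φ.Realize x) :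
    ∃ b : ℕ, ∀ Q : Set ℕ, F ⊆ Q → (∀ q ∈ Q, q ∉ F → b < q) → ∀ y : Fin n → avoidingGroup Q,
      (∀ i, (y i : ℚ) = x i) → φ.Realize y := by
  obtain ⟨S, hS⟩ := hφ.exists_finset_realize hα h
  refine ⟨S.sup fun s => (s : ℚ).den, fun Q hFQ hQ y hy => ?_⟩
  refine hS (avoidingGroup Q) ((AddSubgroup.inclusion (avoidingGroup_anti hFQ)).toGroupLangEmbedding
    (AddSubgroup.inclusion_injective _)) y (funext fun i => Subtype.ext (hy i)) ?_
  intro s hs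
  refine ⟨⟨s, fun p hp => ⟨(s.2 p hp).1, fun hpQ => ?_⟩⟩, rfl⟩
  by_cases hpF : p ∈ F
  · exact (s.2 p hp).2 hpF
  · refine padicNorm_le_one_of_den_lt hp (lt_of_le_of_lt ?_ (hQ p hpQ hpF))
    exact Finset.le_sup (f := fun s : avoidingGroup F => (s : ℚ).den) hs

/-- A set of primes meeting countably many requirements, each determined by a finite stage of the
construction and met as soon as all later primes exceed a certain bound. -/
theorem exists_infinite_primes_of_bounds (b : Finset ℕ → ℕ → ℕ) :
    ∃ Q : Set ℕ, (∀ p ∈ Q, p.Prime) ∧ Q.Infinite ∧ ∀ k, ∃ F : Finset ℕ, (∀ p ∈ F, p.Prime) ∧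
      (F : Set ℕ) ⊆ Q ∧ ∀ q ∈ Q, q ∉ F → b F k < q := by
  choose g hg using Nat.exists_infinite_primes
  -- A state is the set of primes chosen so far with the last one chosen; the next prime exceeds
  -- that one and the bound of requirement `k`.
  let q (s : Finset ℕ × ℕ) (k : ℕ) : ℕ := g (max s.2 (b s.1 k) + 1)
  let s : ℕ → Finset ℕ × ℕ := fun k => Nat.rec (∅, 0) (fun k s => (insert (q s k) s.1, q s k)) k
  have hsucc (k : ℕ) : s (k + 1) = (insert (q (s k) k) (s k).1, q (s k) k) := rfl
  have hlt (k : ℕ) : max (s k).2 (b (s k).1 k) < q (s k) k := (hg _).1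
  have hprime (k : ℕ) : ∀ p ∈ (s k).1, p.Prime := by
    induction k with
    | zero => simp [s]
    | succ k ih =>
      intro p hp
      rw [hsucc, Finset.mem_insert] at hp
      rcases hp with rfl | hp
      · exact (hg _).2
      · exact ih p hp
  have hmono : Monotone fun k => (s k).1 :=
    monotone_nat_of_le_succ fun k => by
      simp only [hsucc]
      exact Finset.subset_insert _ _
  have hle (k : ℕ) : k ≤ (s k).2 := by
    induction k with
    | zero => exact Nat.zero_le _
    | succ k ih =>
      have := hlt k
      rw [hsucc]
      simp only
      omega
  -- Every prime added from stage `k` on is at least the one added at stage `k`, hence exceeds the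
  -- bound of requirement `k`.
  have hnew (k j : ℕ) : q (s k) k ≤ (s (k + 1 + j)).2 ∧
      ∀ p ∈ (s (k + 1 + j)).1, p ∈ (s k).1 ∨ q (s k) k ≤ p := by
    induction j with
    | zero =>
      rw [add_zero, hsucc]
      exact ⟨le_rfl, fun p hp => (Finset.mem_insert.1 hp).elim (fun h => .inr h.ge) .inl⟩
    | succ j ih =>
      have := hlt (k + 1 + j)
      have hge : q (s k) k ≤ q (s (k + 1 + j)) (k + 1 + j) := by
        have := ih.1
        omega
      rw [← add_assoc, hsucc]
      refine ⟨hge, fun p hp => ?_⟩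
      rcases Finset.mem_insert.1 hp with rfl | hp
      · exact .inr hge
      · exact ih.2 p hp
  refine ⟨⋃ k, ((s k).1 : Set ℕ), ?_, ?_, fun k => ⟨(s k).1, hprime k, ?_, ?_⟩⟩
  · intro p hp
    obtain ⟨k, hk⟩ := Set.mem_iUnion.1 hp
    exact hprime k p hk
  · refine Set.infinite_of_forall_exists_gt fun k => ⟨q (s k) k, ?_, ?_⟩
    · exact Set.mem_iUnion.2 ⟨k + 1, by simp [hsucc]⟩
    · have := hlt k
      have := hle k
      omega
  · exact Set.subset_iUnion (fun k => ((s k).1 : Set ℕ)) k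
  · intro p hp hpk
    obtain ⟨j, hj⟩ := Set.mem_iUnion.1 hp
    have h1 : p ∈ (s (k + 1 + j)).1 := hmono (show j ≤ k + 1 + j by omega) hj
    have h2 := ((hnew k j).2 p h1).resolve_left hpk
    have := hlt k
    omega

/-- A `Π₃` sentence true in the group generated by the reciprocals of primes remains true when
suitable infinitely many primes are removed from the denominators. -/
theorem exists_avoidingGroup_holds {φ : InfSentence groupLang} (hφ : φ.IsPi 3)
    (h : φ.Holds primeRecipGroup) :
    ∃ Q : Set ℕ, (∀ p ∈ Q, p.Prime) ∧ Q.Infinite ∧ φ.Holds (avoidingGroup Q) := by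
  cases hφ with
  | pi m β ψ hβ hψ =>
    -- A requirement is a conjunct with a tuple for its universal variables. Tuples range over ℚ so
    -- that one countable list, fixed before Q is known, serves all the groups.
    obtain ⟨τ, hτ⟩ := exists_surjective_nat (Σ i : ℕ, (Fin (0 + m i) → ℚ))
    have hbound (F : Finset ℕ) (k : ℕ) : ∃ b : ℕ, (∀ p ∈ F, p.Prime) →
        ∀ Q : Set ℕ, (F : Set ℕ) ⊆ Q → (∀ q ∈ Q, q ∉ F → b < q) →
        ∀ y : Fin (0 + m (τ k).1) → avoidingGroup Q, (∀ i, (y i : ℚ) = (τ k).2 i) →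
          (ψ (τ k).1).Realize y := by
      by_cases hF : (∀ p ∈ F, p.Prime) ∧ ∀ i, (τ k).2 i ∈ avoidingGroup F
      · obtain ⟨hF, hx⟩ := hF
        obtain ⟨e⟩ := nonempty_equiv_avoidingGroup hF
        have hFh := (InfSentence.holds_congr e.toGroupLangEquiv _).1 h
        have hr := (InfFormula.realize_alls _ _ _).1 (hFh (τ k).1)
          (fun i => (⟨(τ k).2 i, hx i⟩ : avoidingGroup F)) (Subsingleton.elim _ _)
        obtain ⟨b, hb⟩ := exists_bound_realize (by have := hβ (τ k).1; omega) (hψ (τ k).1) hr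
        exact ⟨b, fun _ => hb⟩
      -- A tuple outside G_F is outside the smaller G_Q too, so nothing is required and any bound
      -- will do.
      · refine ⟨0, fun hF' Q hFQ _ y hy => absurd ⟨hF', fun i => ?_⟩ hF⟩
        rw [← hy i]
        exact avoidingGroup_anti hFQ (y i).2
    choose b hb using hbound
    obtain ⟨Q, hQ, hinf, hQb⟩ := exists_infinite_primes_of_bounds b
    refine ⟨Q, hQ, hinf, fun i => (InfFormula.realize_alls _ _ _).2 fun y _ => ?_⟩
    obtain ⟨k, hk⟩ := hτ ⟨i, fun j => y j⟩
    obtain ⟨F, hF, hFQ, hFb⟩ := hQb k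
    have := hb F k hF Q hFQ hFb
    rw [hk] at this
    exact this y fun _ => rfl

/-! ### No Π₃ Scott sentence. -/

theorem not_isScottSentenceOnOmega {φ : InfSentence groupLang} (hφ : φ.IsPi 3) :
    ¬ IsScottSentenceOnOmega φ primeRecipGroup := by
  intro hS
  -- A subgroup of ℚ containing 1 is countably infinite, so its structure can be carried to ω by a
  -- bijection.
  have key (A : AddSubgroup ℚ) (hA : (1 : ℚ) ∈ A) :
      φ.Holds A ↔ Nonempty (A ≃[groupLang] primeRecipGroup) := by
    have : Infinite A := by
      refine Infinite.of_injective (fun n : ℕ => (⟨n, ?_⟩ : A)) fun m n h => ?_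
      · simpa using A.nsmul_mem hA n
      · exact Nat.cast_injective (R := ℚ) (congrArg Subtype.val h)
    obtain ⟨e⟩ : Nonempty (A ≃ ℕ) := nonempty_equiv_of_countable
    let inst : groupLang.Structure ℕ := e.inducedStructure
    let e' : A ≃[groupLang] ℕ := e.inducedStructureEquiv
    rw [InfSentence.holds_congr e', hS inst]
    exact ⟨fun ⟨f⟩ => ⟨f.comp e'⟩, fun ⟨f⟩ => ⟨f.comp e'.symm⟩⟩
  obtain ⟨Q, hQ, hinf, hh⟩ := exists_avoidingGroup_holds hφ
    ((key primeRecipGroup one_mem_primeRecipGroup).2 ⟨FirstOrder.Language.Equiv.refl _ _⟩)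
  have hone : (1 : ℚ) ∈ avoidingGroup Q := fun p hp => by
    simpa using hp.one_lt.le
  obtain ⟨e⟩ := (key _ hone).1 hh
  exact (isEmpty_equiv_avoidingGroup hQ hinf).false e.symm

theorem mainTheorem11 :
    IsTFAb 1 primeRecipGroup ∧
    (¬ ∃ φ : InfSentence groupLang, φ.IsPi 3 ∧ IsScottSentence φ primeRecipGroup) ∧
    (¬ ∃ φ : InfSentence groupLang, φ.IsPi 3 ∧ IsScottSentenceOnOmega φ primeRecipGroup) ∧
    (¬ ∃ φ : InfFormula groupLang 1, φ.IsSigma 2 ∧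
      φ.Defines (autOrbit groupLang (⟨1, one_mem_primeRecipGroup⟩ : primeRecipGroup))) :=
  ⟨isTFAb_primeRecipGroup,
    fun ⟨_, hφ, hS⟩ => not_isScottSentenceOnOmega hφ fun _ => hS ℕ,
    fun ⟨_, hφ, hS⟩ => not_isScottSentenceOnOmega hφ hS,
    fun ⟨φ, hφ, hdef⟩ => not_defines_autOrbit_one φ hφ hdef⟩
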